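/- Let $m$ and $n$ be positive integers and write $[m]=\{1,\dots,m\}$. Let $\mathcal{P}(m,n)\subset\mathbb{R}^m$ be the partial permutohedron, i.e. the convex hull of all vectors in $\{0,1,\dots,n\}^m$ whose nonzero entries are distinct. A face of $\mathcal{P}(m,n)$ is a set $\mathcal{P}(m,n)\cap\{\mathbf{x}\mid\langle\mathbf{a},\mathbf{x}\rangle=b\}$, where $\langle\mathbf{a},\mathbf{x}\rangle\ge b$ is a linear inequality valid on $\mathcal{P}(m,n)$; a facet is a nonempty face of dimension $\dim\mathcal{P}(m,n)-1$. A chain in the Boolean lattice $\mathcal{B}_m$ of subsets of $[m]$ is a sequence $C=(A_1\subsetneq A_2\subsetneq\cdots\subsetneq A_\ell)$ of subsets of $[m]$ with $\ell\ge1$. A rank $i\ge 0$ is missing from $C$ if no $A_j$ has size $i$ but some $A_j$ has size greater than $i$. Let $\mathcal{C}(m,n)$ be the set of chains such that $|A_\ell\setminus A_1|\le n-1$ if $A_1\neq\varnothing$, and $|A_\ell\setminus A_2|\le n-1$ if $A_1=\varnothing$ and $\ell\ge2$. (That is, $\mathcal{C}(m,n)$ consists of the chain $(\varnothing)$ and all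 other chains whose largest set and smallest nonempty set differ in size by at most $n-1$.) For $C=(A_1\subsetneq\cdots\subsetneq A_\ell)\in\mathcal{C}(m,n)$, let $\mathcal{F}_C$ be the intersection of $\mathcal{P}(m,n)$ with the following hyperplanes: (i) $\{\mathbf{x}\in\mathbb{R}^m\mid x_i=0\}$, for all $i\in[m]\setminus A_\ell$; (ii) $\left\{\mathbf{x}\in\mathbb{R}^m\mid\sum_{i\in A_\ell\setminus A_j}x_i=\binom{n+1}{2}-\binom{n+1-|A_\ell\setminus A_j|}{2}\right\}$, for all $1\le j\le\ell-1$, except that $j=1$ is omitted if $A_1=\varnothing$ and $|A_\ell|\ge n$; (iii) $\left\{\mathbf{x}\in\mathbb{R}^m\mid\sum_{i=1}^m x_i=\binom{n+1}{2}\right\}$, if $A_1=\varnothing$ and $|A_\ell|\ge n$. Then $C\mapsto\mathcal{F}_C$ is a bijection from $\mathcal{C}(m,n)$ to the set of nonempty faces of $\mathcal{P}(m,n)$. For every $C\in\mathcal{C}(m,n)$, each of the listed hyperplanes intersects $\mathcal{P}(m,n)$ in a facet, and if $C$ has exactly $k$ missing ranks then $\mathcal{F}_C$ has dimension $k$. 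-/

import Mathlib

namespace PartialPermutohedron

/-- The vectors in `{0, 1, …, n}^m` whose nonzero entries are distinct. -/
def words (m n : ℕ) : Set (Fin m → ℝ) :=
  {v | ∃ w : Fin m → ℕ, (∀ i, w i ≤ n) ∧ (∀ i j, w i ≠ 0 → w i = w j → i = j) ∧
    v = fun i => (w i : ℝ)}

/-- The partial permutohedron `𝒫(m,n)` in `ℝ^m`. -/
def polytope (m n : ℕ) : Set (Fin m → ℝ) := convexHull ℝ (words m n)

/-- `F` is a face of `P`: it is cut out of `P` by turning a valid linear inequality `⟨a, x⟩ ≥ b`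
into an equality. The empty set and `P` itself (`a = 0`) are allowed. -/
def IsFace {m : ℕ} (P F : Set (Fin m → ℝ)) : Prop :=
  ∃ (a : Fin m → ℝ) (b : ℝ), (∀ x ∈ P, b ≤ a ⬝ᵥ x) ∧ F = P ∩ {x | a ⬝ᵥ x = b}

/-- The dimension of a nonempty convex set: the dimension of its affine hull. -/
noncomputable def dim {m : ℕ} (F : Set (Fin m → ℝ)) : ℕ :=
  Module.finrank ℝ (vectorSpan ℝ F)

/-- A facet of `P` is a nonempty face of dimension `dim P - 1`. -/
def IsFacet {m : ℕ} (P F : Set (Fin m → ℝ)) : Prop :=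
  IsFace P F ∧ F.Nonempty ∧ dim F + 1 = dim P

/-- A (nonempty) chain `A₁ ⊊ A₂ ⊊ ⋯ ⊊ A_ℓ` in the Boolean lattice of subsets of an `m`-element
set. For `C : BoolChain m` one has `ℓ = C.length + 1`, the set `A_j` is `C (j - 1)` (indices
start at `0`), `A₁ = C.head` and `A_ℓ = C.last`. -/
abbrev BoolChain (m : ℕ) : Type := LTSeries (Finset (Fin m))

/-- The ranks `i` missing from a chain: no member has `i` elements, but some member has more
than `i` elements. -/
def missingRanks {m : ℕ} (C : BoolChain m) : Set ℕ :=
  {i | (∀ j, (C j).card ≠ i) ∧ ∃ j, i < (C j).card}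

/-- The set `𝒞(m,n)`: chains with `|A_ℓ ∖ A₁| ≤ n - 1` if `A₁ ≠ ∅`, and with
`|A_ℓ ∖ A₂| ≤ n - 1` if `A₁ = ∅` and `ℓ ≥ 2`. -/
def chains (m n : ℕ) : Set (BoolChain m) :=
  {C | (C.head ≠ ∅ → (C.last \ C.head).card ≤ n - 1) ∧
    (C.head = ∅ → ∀ j : Fin (C.length + 1), (j : ℕ) = 1 → (C.last \ C j).card ≤ n - 1)}

/-- Hyperplanes of the first type: `x_i = 0` for `i ∉ A_ℓ`. -/
def hyperplanesI {m : ℕ} (C : BoolChain m) : Set (Set (Fin m → ℝ)) :=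
  {H | ∃ i : Fin m, i ∉ C.last ∧ H = {x | x i = 0}}

/-- Hyperplanes of the second type:
`∑_{i ∈ A_ℓ ∖ A_j} x_i = binom(n+1, 2) - binom(n+1-|A_ℓ ∖ A_j|, 2)` for `j ≤ ℓ - 1`, where `j = 1`
is left out if `A₁ = ∅` and `|A_ℓ| ≥ n`. -/
def hyperplanesII {m : ℕ} (n : ℕ) (C : BoolChain m) : Set (Set (Fin m → ℝ)) :=
  {H | ∃ j : Fin (C.length + 1), (j : ℕ) < C.length ∧
    ¬ ((j : ℕ) = 0 ∧ C.head = ∅ ∧ n ≤ C.last.card) ∧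
    H = {x | ∑ i ∈ C.last \ C j, x i =
      ((n + 1).choose 2 : ℝ) - ((n + 1 - (C.last \ C j).card).choose 2 : ℝ)}}

/-- Hyperplane of the third type: `∑_i x_i = binom(n+1, 2)`, present if `A₁ = ∅` and
`|A_ℓ| ≥ n`. -/
def hyperplanesIII {m : ℕ} (n : ℕ) (C : BoolChain m) : Set (Set (Fin m → ℝ)) :=
  {H | C.head = ∅ ∧ n ≤ C.last.card ∧ H = {x | ∑ i, x i = ((n + 1).choose 2 : ℝ)}}

/-- All hyperplanes attached to the chain `C`. -/
def hyperplanes {m : ℕ} (n : ℕ) (C : BoolChain m) : Set (Set (Fin m → ℝ)) :=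
  hyperplanesI C ∪ hyperplanesII n C ∪ hyperplanesIII n C

/-- The set `F_C`: the intersection of `𝒫(m,n)` with all hyperplanes attached to `C`. -/
def chainFace {m : ℕ} (n : ℕ) (C : BoolChain m) : Set (Fin m → ℝ) :=
  polytope m n ∩ ⋂₀ hyperplanes n C

end PartialPermutohedron

namespace PartialPermutohedron

/-! On the polytope `x_i ≥ 0` and `∑_{i ∈ S} x_i ≤ cap n |S|`, the right side being `n + (n-1) + ⋯`
with `|S|` terms. `mem_chainFace` shows that `F_C` is the locus where these are equalities for `i ∉
A_ℓ` and for all `S = A_ℓ ∖ A_j`; adding them up shows that it is a face.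

Points of `F_C` come from greedy words: hand out `n, n - 1, …` to `A_ℓ`, later blocks of the chain
first, in any order within a block. The bound defining `𝒞(m,n)` lets any chosen `p ∈ A_ℓ` get a
positive value that beats the rest of its block and all earlier blocks. Swapping two entries of a
block, or zeroing an entry of `A_1`, stays in `F_C`. Such moves span the direction space, giving
dimension `|A_ℓ| - (ℓ - 1)`, the number of missing ranks; they also show which `B ⊆ A_ℓ` give
equalities on `F_C`, so `C` can be recovered.

For surjectivity, let `t` be the larger of `0` and the `n`-th largest entry of a functional `c`. The
sets `{t ≤ c i ≤ v}`, for `v = 0` and the positive values `v ≥ t` of `c`, form a chain, and Abel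
summation writes the deficit of `c ⬝ᵥ x` from its maximum through the slacks of the inequalities
(`exists_chain_maximizing`). -/

/-- The sum of the `k` largest elements of `{0, …, n}`, extended by zeros. -/
def cap (n k : ℕ) : ℕ := ∑ t ∈ Finset.range k, (n - t)

theorem cap_add_choose (n k : ℕ) : cap n k + (n + 1 - k).choose 2 = (n + 1).choose 2 := by
  induction k with
  | zero => simp [cap]
  | succ k ih =>
    rw [← ih, cap, Finset.sum_range_succ, ← cap, add_assoc]
    congr 1
    -- For `k > n` truncated subtraction kills the new summand and both binomials.
    rcases Nat.lt_or_ge n k with h | h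
    · have h1 : n - k = 0 := by omega
      have h2 : n + 1 - (k + 1) = 0 := by omega
      have h3 : n + 1 - k = 0 := by omega
      simp [h1, h3]
    · have h2 : n + 1 - (k + 1) = n - k := by omega
      have h3 : n + 1 - k = n - k + 1 := by omega
      rw [h2, h3, Nat.choose_succ_succ' (n - k) 1, Nat.choose_one_right]

theorem cast_cap (n k : ℕ) :
    (cap n k : ℝ) = ((n + 1).choose 2 : ℝ) - ((n + 1 - k).choose 2 : ℝ) := by
  rw [← cap_add_choose n k]
  push_cast
  ring

theorem cast_cap_of_le {n k : ℕ} (h : n ≤ k) : (cap n k : ℝ) = ((n + 1).choose 2 : ℝ) := by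
  rw [cast_cap, Nat.choose_eq_zero_of_lt (by omega : n + 1 - k < 2)]
  simp

/-- Induction by removing a minimal entry: if it is nonzero, the `k + 1` entries are distinct and
lie between it and `n`, so it is at most `n - k`. -/
theorem sum_word_le_cap {ι : Type*} [DecidableEq ι] {n : ℕ} {w : ι → ℕ} (hle : ∀ i, w i ≤ n)
    (hinj : ∀ i j, w i ≠ 0 → w i = w j → i = j) (S : Finset ι) :
    ∑ i ∈ S, w i ≤ cap n S.card := by
  induction hk : S.card generalizing S with
  | zero => simp [Finset.card_eq_zero.mp hk]
  | succ k ih =>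
    obtain ⟨i, hi, hmin⟩ := S.exists_min_image w (Finset.card_pos.mp (by omega))
    have hcard : (S.erase i).card = k := by rw [Finset.card_erase_of_mem hi]; omega
    rw [← Finset.add_sum_erase S w hi, cap, Finset.sum_range_succ, ← cap, add_comm]
    refine add_le_add (ih _ hcard) ?_
    rcases Nat.eq_zero_or_pos (w i) with h0 | h0
    · omega
    have hmaps : Set.MapsTo w S (Finset.Icc (w i) n) := fun a ha => by
      simp [hmin a ha, hle a]
    have hw : Set.InjOn w S := fun a ha b _ hab => by
      have := hmin a ha
      exact hinj a b (by omega) hab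
    have := Finset.card_le_card_of_injOn w hmaps hw
    rw [Nat.card_Icc] at this
    have := hle i
    omega

/-! ### Valid inequalities and the equations of a chain face -/

variable {m n : ℕ}

theorem dotProduct_le_of_mem_polytope {a : Fin m → ℝ} {b : ℝ}
    (h : ∀ x ∈ words m n, a ⬝ᵥ x ≤ b) {x : Fin m → ℝ} (hx : x ∈ polytope m n) : a ⬝ᵥ x ≤ b := by
  have hc : Convex ℝ {x : Fin m → ℝ | a ⬝ᵥ x ≤ b} :=
    convex_halfSpace_le ⟨fun x y => dotProduct_add a x y, fun c x => dotProduct_smul c a x⟩ b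
  exact convexHull_min h hc hx

theorem indicator_dotProduct (S : Finset (Fin m)) (x : Fin m → ℝ) :
    (fun i => if i ∈ S then (1 : ℝ) else 0) ⬝ᵥ x = ∑ i ∈ S, x i := by
  simp [dotProduct]

theorem sum_le_cap_of_mem_polytope {x : Fin m → ℝ} (hx : x ∈ polytope m n)
    (S : Finset (Fin m)) : ∑ i ∈ S, x i ≤ cap n S.card := by
  rw [← indicator_dotProduct]
  refine dotProduct_le_of_mem_polytope ?_ hx
  rintro _ ⟨w, hle, hinj, rfl⟩
  rw [indicator_dotProduct]
  exact_mod_cast sum_word_le_cap hle hinj S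

theorem nonneg_of_mem_polytope {x : Fin m → ℝ} (hx : x ∈ polytope m n) (i : Fin m) :
    0 ≤ x i := by
  have := dotProduct_le_of_mem_polytope (n := n) (a := Pi.single i (-1)) (b := 0) ?_ hx
  · simpa using this
  · rintro _ ⟨w, -, -, rfl⟩
    simp

theorem sum_univ_le_choose {x : Fin m → ℝ} (hx : x ∈ polytope m n) :
    ∑ i, x i ≤ ((n + 1).choose 2 : ℝ) := by
  refine (sum_le_cap_of_mem_polytope hx _).trans ?_
  rw [cast_cap]
  simp

/-- The face of a chain is cut out by uniform equations. -/
theorem mem_chainFace (C : BoolChain m) (x : Fin m → ℝ) :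
    x ∈ chainFace n C ↔ x ∈ polytope m n ∧ (∀ i, i ∉ C.last → x i = 0) ∧
      ∀ j, ∑ i ∈ C.last \ C j, x i = cap n (C.last \ C j).card := by
  have hall : (∀ i, i ∉ C.last → x i = 0) → ∑ i, x i = ∑ i ∈ C.last, x i := fun h =>
    (Finset.sum_subset (Finset.subset_univ _) fun i _ hi => h i hi).symm
  simp only [chainFace, Set.mem_inter_iff, Set.mem_sInter, hyperplanes]
  refine and_congr_right fun _ => ⟨fun h => ?_, ?_⟩
  · have h0 : ∀ i, i ∉ C.last → x i = 0 := fun i hi => h _ (Or.inl (Or.inl ⟨i, hi, rfl⟩))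
    refine ⟨h0, fun j => ?_⟩
    rcases Nat.lt_or_ge j C.length with hj | hj
    -- In the omitted case (iii) takes over: `x` vanishes off `A_ℓ`, and `cap` has reached the full
    -- binomial.
    · by_cases hc : (j : ℕ) = 0 ∧ C.head = ∅ ∧ n ≤ C.last.card
      · have h3 : ∑ i, x i = ((n + 1).choose 2 : ℝ) := h _ (Or.inr ⟨hc.2.1, hc.2.2, rfl⟩)
        have hCj : C j = ∅ := by
          rw [← hc.2.1, RelSeries.head]
          congr 1
          exact Fin.ext hc.1
        rw [hCj, Finset.sdiff_empty, cast_cap_of_le hc.2.2, ← h3, hall h0]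
      · rw [cast_cap]
        exact h _ (Or.inl (Or.inr ⟨j, hj, hc, rfl⟩))
    · have : j = Fin.last _ := Fin.ext (by simp; omega)
      simp [this, RelSeries.last, cap]
  · rintro ⟨h0, h1⟩ H ((⟨i, hi, rfl⟩ | ⟨j, -, -, rfl⟩) | ⟨hh, hl, rfl⟩)
    · exact h0 i hi
    · rw [Set.mem_ofPred_eq, h1, cast_cap]
    · rw [Set.mem_ofPred_eq, hall h0, ← cast_cap_of_le hl]
      have := h1 0
      rw [show C 0 = ∅ from hh] at this
      simpa using this

/-! ### Levels and greedy words -/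

/-- The number of members of the chain that do not contain `i`. -/
def level (C : BoolChain m) (i : Fin m) : ℕ :=
  (Finset.univ.filter fun j => i ∉ C j).card

/-- By monotonicity the members avoiding `i` form an initial segment, so the level is the index of
the first member containing `i`, or `C.length + 1` if there is none. -/
theorem mem_iff_level_le (C : BoolChain m) (i : Fin m) (j : Fin (C.length + 1)) :
    i ∈ C j ↔ level C i ≤ j := by
  have hmono : Monotone C := C.strictMono.monotone
  constructor
  · intro h
    refine (Finset.card_le_card (t := Finset.Iio j) fun k hk => ?_).trans_eq (Fin.card_Iio j)
    rw [Finset.mem_filter] at hk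
    rw [Finset.mem_Iio]
    exact lt_of_not_ge fun hjk => hk.2 (hmono hjk h)
  · intro h
    by_contra hi
    have : (Finset.Iic j).card ≤ level C i := Finset.card_le_card fun k hk => by
      rw [Finset.mem_filter]
      exact ⟨Finset.mem_univ _, fun hk' => hi (hmono (Finset.mem_Iic.mp hk) hk')⟩
    rw [Fin.card_Iic] at this
    omega

theorem mem_last_iff (C : BoolChain m) (i : Fin m) : i ∈ C.last ↔ level C i ≤ C.length :=
  mem_iff_level_le C i (Fin.last _)

theorem mem_head_iff (C : BoolChain m) (i : Fin m) : i ∈ C.head ↔ level C i = 0 := by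
  rw [RelSeries.head, mem_iff_level_le]
  simp

theorem mem_last_sdiff_iff (C : BoolChain m) (i : Fin m) (j : Fin (C.length + 1)) :
    i ∈ C.last \ C j ↔ j < level C i ∧ level C i ≤ C.length := by
  rw [Finset.mem_sdiff, mem_last_iff, mem_iff_level_le]
  omega

theorem level_le (C : BoolChain m) (i : Fin m) : level C i ≤ C.length + 1 :=
  (Finset.card_le_univ _).trans_eq (Fintype.card_fin _)

/-- The word that gives the values `n, n - 1, …` to the elements of `A`, in the order of
decreasing keys. -/
def greedyWord (n : ℕ) (A : Finset (Fin m)) (key : Fin m → ℕ) (i : Fin m) : ℕ :=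
  if i ∈ A then n - (A.filter fun k => key i < key k).card else 0

theorem card_filter_key_lt {A : Finset (Fin m)} {key : Fin m → ℕ} {i k : Fin m} (hk : k ∈ A)
    (h : key i < key k) :
    (A.filter fun l => key k < key l).card < (A.filter fun l => key i < key l).card := by
  refine Finset.card_lt_card (Finset.ssubset_iff_of_subset ?_ |>.mpr ⟨k, ?_, ?_⟩)
  · intro l hl
    rw [Finset.mem_filter] at hl ⊢
    exact ⟨hl.1, h.trans hl.2⟩
  · simp [hk, h]
  · simp

theorem injOn_card_filter_key (A : Finset (Fin m)) {key : Fin m → ℕ}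
    (hkey : Function.Injective key) :
    Set.InjOn (fun i => (A.filter fun l => key i < key l).card) (A : Set (Fin m)) := by
  intro i hi k hk h
  simp only at h
  by_contra hne
  rcases lt_or_gt_of_ne (hkey.ne hne) with h' | h'
  · exact absurd (card_filter_key_lt hk h') (by omega)
  · exact absurd (card_filter_key_lt hi h') (by omega)

theorem greedyWord_mem_words (n : ℕ) (A : Finset (Fin m)) {key : Fin m → ℕ}
    (hkey : Function.Injective key) : (fun i => (greedyWord n A key i : ℝ)) ∈ words m n := by
  refine ⟨greedyWord n A key, fun i => ?_, fun i k hi h => ?_, rfl⟩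
  · unfold greedyWord; split_ifs <;> omega
  · unfold greedyWord at hi h
    split_ifs at hi h with h1 h2
    · exact injOn_card_filter_key A hkey h1 h2 (by simp only; omega)
    all_goals omega

/-- An upper set `S` of `A` consists of the top `|S|` keys, so its ranks are exactly `0, …, |S| -
1`. -/
theorem sum_greedyWord (n : ℕ) {A S : Finset (Fin m)} {key : Fin m → ℕ}
    (hkey : Function.Injective key) (hS : S ⊆ A)
    (hup : ∀ i ∈ S, ∀ k ∈ A, key i < key k → k ∈ S) :
    ∑ i ∈ S, greedyWord n A key i = cap n S.card := by
  have hinj : Set.InjOn (fun i => (A.filter fun l => key i < key l).card) (S : Set (Fin m)) :=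
    (injOn_card_filter_key A hkey).mono (Finset.coe_subset.mpr hS)
  have himg : S.image (fun i => (A.filter fun l => key i < key l).card) =
      Finset.range S.card := by
    refine Finset.eq_of_subset_of_card_le (fun r hr => ?_) ?_
    · obtain ⟨i, hi, rfl⟩ := Finset.mem_image.mp hr
      rw [Finset.mem_range]
      refine Finset.card_lt_card (Finset.ssubset_iff_of_subset (fun l hl => ?_) |>.mpr
        ⟨i, hi, by simp⟩)
      rw [Finset.mem_filter] at hl
      exact hup i hi l hl.1 hl.2
    · rw [Finset.card_image_of_injOn hinj, Finset.card_range]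
  rw [cap, ← himg, Finset.sum_image hinj]
  exact Finset.sum_congr rfl fun i hi => by simp [greedyWord, hS hi]

/-- The priority of `i` in a greedy word for the face of `C`: the level, and then `tie`. -/
def levelKey (C : BoolChain m) (tie : Fin m → ℕ) (i : Fin m) : ℕ := level C i * (m + 1) + tie i

/-- Ties are at most `m`, so the factor `m + 1` makes the key lexicographic. -/
theorem levelKey_lt (C : BoolChain m) {tie : Fin m → ℕ} (ht : ∀ i, tie i ≤ m) {i k : Fin m}
    (h : level C i < level C k) : levelKey C tie i < levelKey C tie k := by
  unfold levelKey
  have := ht i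
  nlinarith

theorem level_le_of_levelKey_lt (C : BoolChain m) {tie : Fin m → ℕ} (ht : ∀ i, tie i ≤ m)
    {i k : Fin m} (h : levelKey C tie i < levelKey C tie k) : level C i ≤ level C k :=
  le_of_not_gt fun h' => (levelKey_lt C ht h').not_gt h

theorem levelKey_injective (C : BoolChain m) {tie : Fin m → ℕ} (ht : ∀ i, tie i ≤ m)
    (hinj : Function.Injective tie) : Function.Injective (levelKey C tie) := by
  intro i k h
  rcases lt_trichotomy (level C i) (level C k) with h' | h' | h'
  · exact absurd h (levelKey_lt C ht h').ne
  · unfold levelKey at h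
    rw [h'] at h
    exact hinj (by omega)
  · exact absurd h (levelKey_lt C ht h').ne'

theorem greedyWord_mem_chainFace (C : BoolChain m) {tie : Fin m → ℕ}
    (ht : ∀ i, tie i ≤ m) (hinj : Function.Injective tie) :
    (fun i => (greedyWord n C.last (levelKey C tie) i : ℝ)) ∈ chainFace n C := by
  have hkey := levelKey_injective C ht hinj
  rw [mem_chainFace]
  refine ⟨subset_convexHull ℝ _ (greedyWord_mem_words n _ hkey), fun i hi => ?_, fun j => ?_⟩
  · simp [greedyWord, hi]
  · rw [← sum_greedyWord n hkey Finset.sdiff_subset]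
    · push_cast; rfl
    · intro i hi k hk h
      have := level_le_of_levelKey_lt C ht h
      rw [mem_last_sdiff_iff] at hi ⊢
      rw [mem_last_iff] at hk
      omega

theorem chainFace_nonempty (n : ℕ) (C : BoolChain m) : (chainFace n C).Nonempty :=
  ⟨_, greedyWord_mem_chainFace C (tie := Fin.val) (fun i => i.2.le) Fin.val_injective⟩

/-- If `A_1 = ∅`, every level is at least `1`, so `C j` contains `A_2`; this is why the definition
of `𝒞(m,n)` may skip an empty `A_1`. -/
theorem card_last_sdiff_lt (hn : 0 < n) {C : BoolChain m} (hC : C ∈ chains m n) {i : Fin m}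
    {j : Fin (C.length + 1)} (hj : (j : ℕ) = level C i) : (C.last \ C j).card < n := by
  have key : (C.last \ C j).card ≤ n - 1 := by
    by_cases hh : C.head = ∅
    · have hi : level C i ≠ 0 := fun h0 => by
        rw [← mem_head_iff, hh] at h0
        simp at h0
      have h1 : 1 < C.length + 1 := by omega
      refine (Finset.card_le_card (Finset.sdiff_subset_sdiff le_rfl ?_)).trans
        (hC.2 hh ⟨1, h1⟩ rfl)
      exact C.strictMono.monotone (Fin.mk_le_of_le_val (by omega))
    · refine (Finset.card_le_card (Finset.sdiff_subset_sdiff le_rfl ?_)).trans (hC.1 hh)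
      exact C.strictMono.monotone (Fin.zero_le j)
  omega

/-- Any element of the largest set of a chain can be the strict maximum among the elements that
are not above it. -/
theorem exists_word_mem_chainFace (hn : 0 < n) {C : BoolChain m} (hC : C ∈ chains m n)
    {p : Fin m} (hp : p ∈ C.last) :
    ∃ w : Fin m → ℕ, (∀ i, w i ≤ n) ∧ (∀ i j, w i ≠ 0 → w i = w j → i = j) ∧
      (fun i => (w i : ℝ)) ∈ chainFace n C ∧ 0 < w p ∧
      ∀ i, i ≠ p → level C i ≤ level C p → w i < w p := by
  -- The tie `m` exceeds every index, so `p` wins its block.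
  let tie : Fin m → ℕ := fun i => if i = p then m else i
  have ht : ∀ i, tie i ≤ m := fun i => by
    simp only [tie]; split_ifs <;> omega
  have hinj : Function.Injective tie := fun i k h => by
    simp only [tie] at h; split_ifs at h <;> omega
  have hmax : ∀ i, i ≠ p → level C i ≤ level C p → levelKey C tie i < levelKey C tie p := by
    intro i hi h
    rcases h.lt_or_eq with h | h
    · exact levelKey_lt C ht h
    · simp only [levelKey, h, tie, hi, if_true, if_false]
      omega
  have hkey := levelKey_injective C ht hinj
  have hlp := (mem_last_iff C p).mp hp
  -- Only elements of strictly larger level precede `p`, fewer than `n` of them, so the value of `p`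
  -- is not truncated to `0`.
  have hlt : (C.last.filter fun k => levelKey C tie p < levelKey C tie k).card < n := by
    refine lt_of_le_of_lt (Finset.card_le_card fun k hk => ?_)
      (card_last_sdiff_lt hn hC (i := p) (j := ⟨level C p, by omega⟩) rfl)
    rw [Finset.mem_filter] at hk
    rw [mem_last_sdiff_iff]
    refine ⟨lt_of_not_ge fun h => ?_, (mem_last_iff C k).mp hk.1⟩
    exact (hmax k (fun e => by simp [e] at hk) h).not_gt hk.2
  obtain ⟨w, hle, hw, hwe⟩ := greedyWord_mem_words n C.last hkey
  obtain rfl : greedyWord n C.last (levelKey C tie) = w :=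
    funext fun i => by exact_mod_cast congrFun hwe i
  refine ⟨_, hle, hw, greedyWord_mem_chainFace C ht hinj, ?_, fun i hi h => ?_⟩
  · simp only [greedyWord, hp, if_true]; omega
  · have := card_filter_key_lt hp (hmax i hi h)
    have hil : i ∈ C.last := (mem_last_iff C i).mpr (h.trans hlp)
    simp only [greedyWord, hp, hil, if_true]
    omega


/-- An element of level `0` lies in no `A_ℓ ∖ A_j`, so no equation sees its coordinate. -/
theorem update_zero_mem_chainFace {C : BoolChain m} {w : Fin m → ℕ} (hle : ∀ i, w i ≤ n)
    (hinj : ∀ i j, w i ≠ 0 → w i = w j → i = j) (hw : (fun i => (w i : ℝ)) ∈ chainFace n C)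
    {p : Fin m} (hp : level C p = 0) :
    (fun i => ((Function.update w p 0) i : ℝ)) ∈ chainFace n C := by
  rw [mem_chainFace] at hw ⊢
  obtain ⟨-, h0, h1⟩ := hw
  refine ⟨subset_convexHull ℝ _ ⟨Function.update w p 0, fun i => ?_, fun i j hi h => ?_, rfl⟩,
    fun i hi => ?_, fun j => ?_⟩
  · simp only [Function.update_apply]; split_ifs <;> simp [hle]
  · simp only [Function.update_apply] at hi h
    split_ifs at hi h <;> first | omega | exact hinj i j hi h
  · simp only [Function.update_apply]
    split_ifs
    · simp
    · exact h0 i hi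
  · rw [← h1 j]
    refine Finset.sum_congr rfl fun i hi => ?_
    rw [Function.update_of_ne]
    rintro rfl
    rw [mem_last_sdiff_iff] at hi
    omega

theorem comp_swap_mem_words {w : Fin m → ℕ} (hle : ∀ i, w i ≤ n)
    (hinj : ∀ i j, w i ≠ 0 → w i = w j → i = j) (p q : Fin m) :
    (fun i => (w (Equiv.swap p q i) : ℝ)) ∈ words m n :=
  ⟨w ∘ Equiv.swap p q, fun _ => hle _, fun _ _ hi h => (Equiv.swap p q).injective (hinj _ _ hi h),
    rfl⟩

theorem comp_swap_sub (w : Fin m → ℕ) (p q : Fin m) :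
    (fun i => (w i : ℝ)) - (fun i => (w (Equiv.swap p q i) : ℝ)) =
      ((w p : ℝ) - w q) • (Pi.single p (1 : ℝ) - Pi.single q 1) := by
  ext i
  by_cases hp : i = p
  · subst hp
    by_cases hq : i = q
    · simp [hq]
    · simp [hq]
  · by_cases hq : i = q
    · subst hq
      simp [hp]
    · simp [hp, hq, Equiv.swap_apply_of_ne_of_ne]

theorem comp_swap_mem_chainFace {C : BoolChain m} {w : Fin m → ℕ} (hle : ∀ i, w i ≤ n)
    (hinj : ∀ i j, w i ≠ 0 → w i = w j → i = j) (hw : (fun i => (w i : ℝ)) ∈ chainFace n C)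
    {p q : Fin m} (hpq : level C p = level C q) :
    (fun i => (w (Equiv.swap p q i) : ℝ)) ∈ chainFace n C := by
  have hlev : ∀ i, level C (Equiv.swap p q i) = level C i := fun i => by
    rw [Equiv.swap_apply_def]
    split_ifs with h1 h2
    · rw [h1, hpq]
    · rw [h2, hpq]
    · rfl
  rw [mem_chainFace] at hw ⊢
  obtain ⟨-, h0, h1⟩ := hw
  refine ⟨subset_convexHull ℝ _ (comp_swap_mem_words hle hinj p q), fun i hi => ?_, fun j => ?_⟩
  · refine h0 _ ?_
    rwa [mem_last_iff, hlev, ← mem_last_iff]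
  · rw [← h1 j]
    refine Finset.sum_equiv (Equiv.swap p q) (fun i => ?_) fun i _ => rfl
    rw [mem_last_sdiff_iff, mem_last_sdiff_iff, hlev]

/-! ### Dimension of a chain face -/

/-- The linear map whose kernel is the direction of the face of `C`: the coordinates outside the
largest set, and the sums over the blocks between consecutive members. -/
def blockMap (C : BoolChain m) :
    (Fin m → ℝ) →ₗ[ℝ] ({i // i ∉ C.last} → ℝ) × (Fin C.length → ℝ) where
  toFun v := (fun i => v i, fun j => ∑ i with level C i = j + 1, v i)
  map_add' u v := by
    ext <;> simp [Finset.sum_add_distrib]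
  map_smul' c v := by
    ext <;> simp [Finset.mul_sum]

theorem exists_level_eq (C : BoolChain m) (j : Fin C.length) : ∃ i, level C i = j + 1 := by
  obtain ⟨i, hi, hi'⟩ := Finset.exists_of_ssubset (C.step j)
  refine ⟨i, ?_⟩
  have h1 := (mem_iff_level_le C i _).mp hi
  have h2 := (mem_iff_level_le C i _).not.mp hi'
  simp at h1 h2
  omega

theorem blockMap_surjective (C : BoolChain m) : Function.Surjective (blockMap C) := by
  choose p hp using exists_level_eq C
  have hpl : ∀ j, p j ∈ C.last := fun j => by rw [mem_last_iff, hp]; omega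
  rintro ⟨y, z⟩
  -- The whole prescribed sum of a block is put on its representative `p j`.
  refine ⟨fun i => if h : i ∈ C.last then ∑ j, if i = p j then z j else 0 else y ⟨i, h⟩, ?_⟩
  refine Prod.ext (funext fun i => ?_) (funext fun j => ?_)
  · simp [blockMap, i.2]
  · have h1 : ∀ i ∈ Finset.univ.filter (fun i => level C i = j + 1),
        (if h : i ∈ C.last then ∑ j, if i = p j then z j else 0 else y ⟨i, h⟩) =
          ∑ j, if i = p j then z j else 0 := fun i hi => by
      rw [Finset.mem_filter] at hi
      rw [dif_pos]
      rw [mem_last_iff]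
      omega
    simp only [blockMap, LinearMap.coe_mk, AddHom.coe_mk]
    rw [Finset.sum_congr rfl h1, Finset.sum_comm]
    simp only [Finset.sum_ite_eq', Finset.mem_filter, Finset.mem_univ, true_and, hp,
      add_left_inj, Fin.val_inj]
    simp

theorem finrank_ker_blockMap (C : BoolChain m) :
    Module.finrank ℝ (LinearMap.ker (blockMap C)) + C.length = C.last.card := by
  have h := LinearMap.finrank_range_add_finrank_ker (blockMap C)
  rw [LinearMap.range_eq_top.mpr (blockMap_surjective C), finrank_top, Module.finrank_prod,
    Module.finrank_fintype_fun_eq_card, Module.finrank_fintype_fun_eq_card,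
    Module.finrank_fintype_fun_eq_card, Fintype.card_fin, Fintype.card_fin,
    Fintype.card_subtype_compl, Fintype.card_coe, Fintype.card_fin] at h
  have := C.last.card_le_univ
  rw [Fintype.card_fin] at this
  omega

theorem sum_level_eq (C : BoolChain m) (j : Fin C.length) (x : Fin m → ℝ) :
    ∑ i with level C i = j + 1, x i =
      ∑ i ∈ C.last \ C j.castSucc, x i - ∑ i ∈ C.last \ C j.succ, x i := by
  rw [eq_sub_iff_add_eq, ← Finset.sum_union]
  · congr 1
    ext i
    simp only [Finset.mem_union, mem_last_sdiff_iff, Finset.mem_filter, Finset.mem_univ, true_and,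
      Fin.val_castSucc, Fin.val_succ]
    omega
  · rw [Finset.disjoint_left]
    intro i h1 h2
    rw [mem_last_sdiff_iff, Fin.val_succ] at h2
    rw [Finset.mem_filter] at h1
    omega

theorem vectorSpan_chainFace_le (C : BoolChain m) :
    vectorSpan ℝ (chainFace n C) ≤ LinearMap.ker (blockMap C) := by
  rw [vectorSpan_def, Submodule.span_le]
  rintro _ ⟨x, hx, y, hy, rfl⟩
  simp only
  rw [mem_chainFace] at hx hy
  rw [SetLike.mem_coe, vsub_eq_sub, LinearMap.sub_mem_ker_iff]
  refine Prod.ext (funext fun i => ?_) (funext fun j => ?_)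
  · exact (hx.2.1 i i.2).trans (hy.2.1 i i.2).symm
  · simp only [blockMap, LinearMap.coe_mk, AddHom.coe_mk]
    rw [sum_level_eq, sum_level_eq, hx.2.2, hx.2.2, hy.2.2, hy.2.2]

theorem single_mem_vectorSpan (hn : 0 < n) {C : BoolChain m} (hC : C ∈ chains m n) {p : Fin m}
    (hp : level C p = 0) : Pi.single p (1 : ℝ) ∈ vectorSpan ℝ (chainFace n C) := by
  obtain ⟨w, hle, hinj, hw, hpos, -⟩ :=
    exists_word_mem_chainFace hn hC ((mem_last_iff C p).mpr (by omega))
  have h := vsub_mem_vectorSpan ℝ hw (update_zero_mem_chainFace hle hinj hw hp)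
  have he : ((fun i => (w i : ℝ)) -ᵥ fun i => ((Function.update w p 0) i : ℝ)) =
      (w p : ℝ) • Pi.single p (1 : ℝ) := by
    ext i
    by_cases hi : i = p
    · subst hi; simp
    · simp [hi]
  rw [he] at h
  exact (Submodule.smul_mem_iff _ (by positivity)).mp h

theorem single_sub_single_mem_vectorSpan (hn : 0 < n) {C : BoolChain m} (hC : C ∈ chains m n)
    {p q : Fin m} (hp : p ∈ C.last) (hpq : level C q = level C p) :
    Pi.single p (1 : ℝ) - Pi.single q 1 ∈ vectorSpan ℝ (chainFace n C) := by
  by_cases hne : q = p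
  · simp [hne]
  obtain ⟨w, hle, hinj, hw, -, hlt⟩ := exists_word_mem_chainFace hn hC hp
  have h := vsub_mem_vectorSpan ℝ hw (comp_swap_mem_chainFace hle hinj hw hpq.symm)
  rw [vsub_eq_sub, comp_swap_sub] at h
  refine (Submodule.smul_mem_iff _ (sub_ne_zero.mpr ?_)).mp h
  exact_mod_cast (hlt q hne hpq.le).ne'

theorem ker_blockMap_le (hn : 0 < n) {C : BoolChain m} (hC : C ∈ chains m n) :
    LinearMap.ker (blockMap C) ≤ vectorSpan ℝ (chainFace n C) := by
  intro v hv
  have h0 : ∀ i, i ∉ C.last → v i = 0 := fun i hi => congrFun (congrArg Prod.fst hv) ⟨i, hi⟩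
  have h1 : ∀ j : Fin C.length, ∑ i with level C i = j + 1, v i = 0 := fun j =>
    congrFun (congrArg Prod.snd hv) j
  have hv' : v = ∑ i, v i • Pi.single i (1 : ℝ) := by
    ext i
    simp [Finset.sum_apply, Pi.single_apply]
  rw [hv', ← Finset.sum_fiberwise_of_maps_to (s := Finset.univ)
    (t := Finset.range (C.length + 2)) (g := level C)
    fun i _ => Finset.mem_range.mpr (Nat.lt_succ_of_le (level_le C i))]
  refine Submodule.sum_mem _ fun r hr => ?_
  rw [Finset.mem_range] at hr
  rcases Nat.eq_zero_or_pos r with rfl | hr0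
  · refine Submodule.sum_mem _ fun i hi => Submodule.smul_mem _ _ ?_
    exact single_mem_vectorSpan hn hC (Finset.mem_filter.mp hi).2
  rcases Nat.lt_or_ge C.length r with hr1 | hr1
  · refine Submodule.sum_mem _ fun i hi => ?_
    rw [h0 i, zero_smul]
    · exact Submodule.zero_mem _
    · rw [mem_last_iff, (Finset.mem_filter.mp hi).2]
      omega
  obtain ⟨j, rfl⟩ : ∃ j : Fin C.length, r = j + 1 := ⟨⟨r - 1, by omega⟩, by simp; omega⟩
  obtain ⟨p, hp⟩ := exists_level_eq C j
  -- The entries of the block sum to zero, so subtracting `e_p` from each basis vector changes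
  -- nothing.
  have he : ∑ i with level C i = j + 1, v i • Pi.single i (1 : ℝ) =
      ∑ i with level C i = j + 1, v i • (Pi.single i (1 : ℝ) - Pi.single p 1) := by
    simp only [smul_sub]
    rw [Finset.sum_sub_distrib, ← Finset.sum_smul, h1 j, zero_smul, sub_zero]
  rw [he]
  refine Submodule.sum_mem _ fun i hi => Submodule.smul_mem _ _ ?_
  have hi' := (Finset.mem_filter.mp hi).2
  exact single_sub_single_mem_vectorSpan hn hC ((mem_last_iff C i).mpr (by omega))
    (hp.trans hi'.symm)

theorem dim_chainFace_add_length (hn : 0 < n) {C : BoolChain m} (hC : C ∈ chains m n) :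
    dim (chainFace n C) + C.length = C.last.card := by
  rw [dim, le_antisymm (vectorSpan_chainFace_le C) (ker_blockMap_le hn hC), finrank_ker_blockMap]

/-- The members before the last have distinct sizes below `|A_ℓ|`; the other ranks below `|A_ℓ|` are
the missing ones. -/
theorem ncard_missingRanks_add_length (C : BoolChain m) :
    (missingRanks C).ncard + C.length = C.last.card := by
  have hmono : StrictMono fun j => (C j).card := fun i j h => Finset.card_lt_card (C.strictMono h)
  let f : Fin C.length → ℕ := fun j => (C j.castSucc).card
  have hf : Function.Injective f := fun i j h => by
    simpa using hmono.injective h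
  have hlt : ∀ j, f j < C.last.card := fun j => hmono (Fin.castSucc_lt_last j)
  have he : missingRanks C = ↑(Finset.range C.last.card \ Finset.univ.image f) := by
    ext r
    simp only [missingRanks, Set.mem_ofPred_eq, Finset.coe_sdiff, Finset.coe_range, Set.mem_sdiff,
      Set.mem_Iio, Finset.coe_image, Finset.coe_univ, Set.image_univ, Set.mem_range, not_exists]
    constructor
    · rintro ⟨h1, j, hj⟩
      exact ⟨hj.trans_le (hmono.monotone (Fin.le_last j)), fun j => h1 _⟩
    · rintro ⟨h1, h2⟩
      refine ⟨fun j => ?_, Fin.last _, h1⟩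
      refine Fin.lastCases ?_ (fun j => h2 j) j
      exact h1.ne'
  have hsub : Finset.univ.image f ⊆ Finset.range C.last.card := fun r hr => by
    obtain ⟨j, -, rfl⟩ := Finset.mem_image.mp hr
    exact Finset.mem_range.mpr (hlt j)
  have hle := Finset.card_le_card hsub
  rw [he, Set.ncard_coe_finset, Finset.card_sdiff_of_subset hsub]
  rw [Finset.card_image_of_injective _ hf] at hle ⊢
  simp only [Finset.card_range, Finset.card_univ, Fintype.card_fin] at hle ⊢
  omega

theorem dim_chainFace (hn : 0 < n) {C : BoolChain m} (hC : C ∈ chains m n) :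
    dim (chainFace n C) = (missingRanks C).ncard := by
  have h1 := dim_chainFace_add_length hn hC
  have h2 := ncard_missingRanks_add_length C
  omega

/-! ### Injectivity -/

theorem mem_last_iff_exists (hn : 0 < n) {C : BoolChain m} (hC : C ∈ chains m n) (i : Fin m) :
    i ∈ C.last ↔ ∃ x ∈ chainFace n C, x i ≠ 0 := by
  constructor
  · intro hi
    obtain ⟨w, -, -, hw, hpos, -⟩ := exists_word_mem_chainFace hn hC hi
    exact ⟨_, hw, by positivity⟩
  · rintro ⟨x, hx, hxi⟩
    by_contra hi
    exact hxi (((mem_chainFace C x).mp hx).2.1 i hi)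

/-- The members of a chain are determined by its face. -/
theorem mem_range_iff (hn : 0 < n) {C : BoolChain m} (hC : C ∈ chains m n) (B : Finset (Fin m)) :
    B ∈ Set.range C ↔ B ⊆ C.last ∧
      ∀ x ∈ chainFace n C, ∑ i ∈ C.last \ B, x i = cap n (C.last \ B).card := by
  constructor
  · rintro ⟨j, rfl⟩
    exact ⟨C.strictMono.monotone (Fin.le_last j), fun x hx => ((mem_chainFace C x).mp hx).2.2 j⟩
  rintro ⟨hB, hmax⟩
  -- Otherwise swapping the larger entry at `p ∈ B` with the one at `i` would push the sum above
  -- `cap`.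
  have hup : ∀ i ∈ C.last \ B, ∀ p ∈ C.last, level C i ≤ level C p → p ∈ C.last \ B := by
    intro i hi p hp hip
    by_contra hpB
    have hne : i ≠ p := by rintro rfl; exact hpB hi
    obtain ⟨w, hle, hinj, hw, -, hlt⟩ := exists_word_mem_chainFace hn hC hp
    have h1 := hmax _ hw
    have h2 := sum_le_cap_of_mem_polytope (S := C.last \ B)
      (subset_convexHull ℝ _ (comp_swap_mem_words hle hinj p i))
    have h3 := congrArg (fun x => ∑ k ∈ C.last \ B, x k) (comp_swap_sub w p i)
    simp only [Pi.sub_apply, Pi.smul_apply, smul_eq_mul, Finset.sum_sub_distrib,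
      ← Finset.mul_sum, Pi.single_apply, Finset.sum_ite_eq', hi, hpB, if_true, if_false] at h3
    have h4 : (w i : ℝ) < w p := by exact_mod_cast hlt i hne hip
    linarith
  -- Otherwise zeroing the positive entry at `i` would lower a sum that is constant on the face.
  have hzero : ∀ i, level C i = 0 → i ∈ B := by
    intro i hi0
    by_contra hiB
    have hi : i ∈ C.last := (mem_last_iff C i).mpr (by omega)
    have hiS : i ∈ C.last \ B := Finset.mem_sdiff.mpr ⟨hi, hiB⟩
    obtain ⟨w, hle, hinj, hw, hpos, -⟩ := exists_word_mem_chainFace hn hC hi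
    have h1 := hmax _ hw
    have h2 := hmax _ (update_zero_mem_chainFace hle hinj hw hi0)
    rw [← h2] at h1
    norm_cast at h1
    rw [← Finset.add_sum_erase _ _ hiS, ← Finset.add_sum_erase _ _ hiS, Function.update_self] at h1
    have : ∑ k ∈ (C.last \ B).erase i, Function.update w i 0 k =
        ∑ k ∈ (C.last \ B).erase i, w k := Finset.sum_congr rfl fun k hk => by
      rw [Function.update_of_ne (Finset.ne_of_mem_erase hk)]
    omega
  -- The least member containing `B` equals `B`: by minimality `B` has an element of that level if
  -- it is positive, so `hup` leaves no room for an extra element.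
  have hex : ∃ r, ∃ h : r < C.length + 1, B ⊆ C ⟨r, h⟩ := ⟨C.length, by omega, hB⟩
  classical
  obtain ⟨h, hr⟩ := Nat.find_spec hex
  refine ⟨⟨_, h⟩, subset_antisymm (fun i hi => ?_) hr⟩
  by_contra hiB
  have hlev := (mem_iff_level_le C i _).mp hi
  simp only at hlev
  have hil : i ∈ C.last := (mem_last_iff C i).mpr (by omega)
  rcases Nat.eq_zero_or_pos (Nat.find hex) with h0 | h0
  · exact hiB (hzero i (by omega))
  have hmin := Nat.find_min hex (Nat.sub_one_lt (by omega))
  have h' : Nat.find hex - 1 < C.length + 1 := by omega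
  obtain ⟨k, hk, hk'⟩ := Finset.not_subset.mp fun hs => hmin ⟨h', hs⟩
  rw [mem_iff_level_le] at hk'
  simp only at hk'
  exact (Finset.mem_sdiff.mp (hup i (Finset.mem_sdiff.mpr ⟨hil, hiB⟩) k (hB hk) (by omega))).2 hk

theorem boolChain_ext {C D : BoolChain m} (h : Set.range C = Set.range D) : C = D := by
  have hlen : C.length = D.length := by
    have h1 := Set.ncard_range_of_injective C.strictMono.injective
    have h2 := Set.ncard_range_of_injective D.strictMono.injective
    rw [h, h2] at h1
    simpa using h1.symm
  obtain ⟨k, f, hf⟩ := C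
  obtain ⟨l, g, hg⟩ := D
  obtain rfl : k = l := hlen
  have : f = g := (StrictMono.range_inj (LTSeries.strictMono ⟨k, f, hf⟩)
    (LTSeries.strictMono ⟨k, g, hg⟩)).mp h
  subst this
  rfl

theorem chainFace_injOn (hn : 0 < n) :
    Set.InjOn (fun C : BoolChain m => chainFace n C) (chains m n) := by
  intro C hC D hD h
  simp only at h
  have hl : C.last = D.last := by
    ext i
    rw [mem_last_iff_exists hn hC, mem_last_iff_exists hn hD, h]
  refine boolChain_ext (Set.ext fun B => ?_)
  rw [mem_range_iff hn hC, mem_range_iff hn hD, h, hl]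


/-! ### Every face comes from a chain -/

/-- The threshold is the `n`-th largest entry of `c` if this exists and is positive, and `0`
otherwise. -/
theorem exists_threshold (hn : 0 < n) (c : Fin m → ℝ) :
    ∃ t : ℝ, 0 ≤ t ∧ (Finset.univ.filter fun i => t < c i).card ≤ n - 1 ∧
      (0 < t → n ≤ (Finset.univ.filter fun i => t ≤ c i).card) := by
  let T : Finset ℝ := insert 0 ((Finset.univ.image c).filter fun v =>
    0 < v ∧ n ≤ (Finset.univ.filter fun i => v ≤ c i).card)
  obtain ⟨t, ht, hmax⟩ := T.exists_max_image id ⟨0, Finset.mem_insert_self _ _⟩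
  have ht0 : 0 ≤ t := hmax 0 (Finset.mem_insert_self _ _)
  refine ⟨t, ht0, ?_, fun hpos => ?_⟩
  · by_contra! hlt
    obtain ⟨i, hi, hmin⟩ := (Finset.univ.filter fun i => t < c i).exists_min_image c
      (Finset.card_pos.mp (by omega))
    have hti : t < c i := (Finset.mem_filter.mp hi).2
    refine (hmax (c i) ?_).not_gt hti
    refine Finset.mem_insert_of_mem (Finset.mem_filter.mpr
      ⟨Finset.mem_image_of_mem _ (Finset.mem_univ _), ht0.trans_lt hti, ?_⟩)
    refine (by omega : n ≤ (Finset.univ.filter fun i => t < c i).card).trans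
      (Finset.card_le_card fun k hk => ?_)
    exact Finset.mem_filter.mpr ⟨Finset.mem_univ _, hmin k hk⟩
  · rcases Finset.mem_insert.mp ht with h | h
    · exact absurd h hpos.ne'
    · exact (Finset.mem_filter.mp h).2.2

theorem sum_steps_below {k : ℕ} {v : Fin (k + 1) → ℝ} (hv : StrictMono v) (r : Fin (k + 1)) :
    ∑ j : Fin k, (if v j.castSucc < v r then v j.succ - v j.castSucc else 0) = v r - v 0 := by
  simp only [hv.lt_iff_lt]
  induction r using Fin.induction with
  | zero => simp
  | succ r ih =>
    have : ∀ j : Fin k, (if j.castSucc < r.succ then v j.succ - v j.castSucc else 0) =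
        (if j.castSucc < r.castSucc then v j.succ - v j.castSucc else 0) +
          if j = r then v r.succ - v r.castSucc else 0 := by
      intro j
      rcases lt_trichotomy j r with h | rfl | h
      · simp [Fin.castSucc_lt_succ_iff, h, h.le, h.ne]
      · simp
      · simp [Fin.castSucc_lt_succ_iff, h.not_ge, h.not_gt, h.ne']
    simp only [this, Finset.sum_add_distrib, ih, Finset.sum_ite_eq', Finset.mem_univ, if_true]
    ring

/-- The chain of the sets `{i | t ≤ c i ≤ v j}`. -/
noncomputable def levelChain (c : Fin m → ℝ) (t : ℝ) {k : ℕ} (v : Fin (k + 1) → ℝ) (hv : StrictMono v)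
    (hval : ∀ j : Fin k, ∃ i, t ≤ c i ∧ c i = v j.succ) : BoolChain m where
  length := k
  toFun j := Finset.univ.filter fun i => t ≤ c i ∧ c i ≤ v j
  step j := by
    obtain ⟨i, hti, hi⟩ := hval j
    have hlt : v j.castSucc < v j.succ := hv (Fin.castSucc_lt_succ)
    refine Finset.ssubset_iff_of_subset (fun l hl => ?_) |>.mpr ⟨i, ?_, ?_⟩
    · rw [Finset.mem_filter] at hl ⊢
      exact ⟨hl.1, hl.2.1, hl.2.2.trans hlt.le⟩
    · simp [← hi, hti]
    · simp [hi, hlt]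

theorem exists_levels (c : Fin m → ℝ) {t : ℝ} (ht : 0 ≤ t) :
    ∃ (k : ℕ) (v : Fin (k + 1) → ℝ), StrictMono v ∧ v 0 = 0 ∧
      (∀ j : Fin k, ∃ i, t ≤ c i ∧ c i = v j.succ) ∧ ∀ i, t ≤ c i → ∃ r, c i = v r := by
  let V : Finset ℝ := insert 0 ((Finset.univ.image c).filter fun s => t ≤ s ∧ 0 < s)
  have h0 : (0 : ℝ) ∈ V := Finset.mem_insert_self _ _
  have hV : ∀ s ∈ V, 0 ≤ s := fun s hs => by
    rcases Finset.mem_insert.mp hs with rfl | hs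
    · rfl
    · exact (Finset.mem_filter.mp hs).2.2.le
  have hk : V.card = V.card - 1 + 1 := by
    have := Finset.card_pos.mpr ⟨0, h0⟩
    omega
  let v := V.orderEmbOfFin hk
  have hrange : Set.range v = V := V.range_orderEmbOfFin hk
  have hv : StrictMono v := v.strictMono
  have hv0 : v 0 = 0 := by
    obtain ⟨r, hr⟩ : (0 : ℝ) ∈ Set.range v := by rw [hrange]; exact h0
    refine le_antisymm ?_ (hV _ (V.orderEmbOfFin_mem hk 0))
    rw [← hr]
    exact hv.monotone (Fin.zero_le r)
  refine ⟨_, v, hv, hv0, fun j => ?_, fun i hi => ?_⟩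
  · have hpos : 0 < v j.succ := hv0 ▸ hv (Fin.succ_pos j)
    rcases Finset.mem_insert.mp (V.orderEmbOfFin_mem hk j.succ) with h | h
    · exact absurd h hpos.ne'
    · obtain ⟨h1, h2, -⟩ := Finset.mem_filter.mp h
      obtain ⟨i, -, hi⟩ := Finset.mem_image.mp h1
      exact ⟨i, hi ▸ h2, hi⟩
  · have : c i ∈ Set.range v := by
      rw [hrange]
      rcases (ht.trans hi).eq_or_lt with h | h
      · rw [← h]; exact h0
      · exact Finset.mem_insert_of_mem (Finset.mem_filter.mpr
          ⟨Finset.mem_image_of_mem _ (Finset.mem_univ _), hi, h⟩)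
    obtain ⟨r, hr⟩ := this
    exact ⟨r, hr.symm⟩

theorem exists_levelChain (c : Fin m → ℝ) {t : ℝ} (ht : 0 ≤ t) :
    ∃ (C : BoolChain m) (v : Fin (C.length + 1) → ℝ), StrictMono v ∧ v 0 = 0 ∧
      (∀ j : Fin C.length, t ≤ v j.succ) ∧ (∀ i, t ≤ c i → ∃ r, c i = v r) ∧
      ∀ j i, i ∈ C j ↔ t ≤ c i ∧ c i ≤ v j := by
  obtain ⟨k, v, hv, hv0, hval, hc⟩ := exists_levels c ht
  refine ⟨levelChain c t v hv hval, v, hv, hv0, fun j => ?_, hc, fun j i => by simp [levelChain]⟩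
  obtain ⟨i, hi, hi'⟩ := hval j
  exact hi.trans_eq hi'

/-- Abel summation: on `A_ℓ` each `c i` is the sum of the steps of `v` below it. -/
theorem dotProduct_eq_sum_levels (c : Fin m → ℝ) {C : BoolChain m} {v : Fin (C.length + 1) → ℝ}
    (hv : StrictMono v) (hv0 : v 0 = 0) (hc : ∀ i ∈ C.last, ∃ r, c i = v r)
    (hmem : ∀ j, ∀ i ∈ C.last, i ∈ C j ↔ c i ≤ v j) (x : Fin m → ℝ) :
    c ⬝ᵥ x = ∑ j : Fin C.length, (v j.succ - v j.castSucc) * ∑ i ∈ C.last \ C j.castSucc, x i +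
      ∑ i ∈ C.lastᶜ, c i * x i := by
  rw [dotProduct, ← Finset.sum_add_sum_compl C.last]
  congr 1
  have h1 : ∀ j : Fin C.length, ∑ i ∈ C.last \ C j.castSucc, x i =
      ∑ i ∈ C.last, if v j.castSucc < c i then x i else 0 := fun j => by
    rw [← Finset.sum_filter]
    refine Finset.sum_congr (Finset.ext fun i => ?_) fun _ _ => rfl
    rw [Finset.mem_sdiff, Finset.mem_filter]
    refine and_congr_right fun hi => ?_
    rw [hmem _ i hi, not_le]
  simp only [h1, Finset.mul_sum]
  rw [Finset.sum_comm]
  refine Finset.sum_congr rfl fun i hi => ?_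
  obtain ⟨r, hr⟩ := hc i hi
  have h2 := sum_steps_below hv r
  rw [hv0, sub_zero] at h2
  rw [hr]
  refine (congrArg (· * x i) h2.symm).trans ?_
  simp only [Finset.sum_mul]
  refine Finset.sum_congr rfl fun j _ => ?_
  split_ifs <;> simp

/-- Every linear functional attains its maximum over the partial permutohedron exactly on the
face of some chain. -/
theorem exists_chain_maximizing (hn : 0 < n) (c : Fin m → ℝ) :
    ∃ C ∈ chains m n, ∃ M : ℝ, ∀ x ∈ polytope m n,
      c ⬝ᵥ x ≤ M ∧ (c ⬝ᵥ x = M ↔ x ∈ chainFace n C) := by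
  obtain ⟨t, ht0, hlt, hge⟩ := exists_threshold hn c
  obtain ⟨C, v, hv, hv0, hval, hc, hmem⟩ := exists_levelChain c ht0
  have hlast : ∀ i, i ∈ C.last ↔ t ≤ c i := fun i => by
    refine (hmem (Fin.last _) i).trans (and_iff_left_of_imp fun hi => ?_)
    obtain ⟨r, hr⟩ := hc i hi
    rw [hr]
    exact hv.monotone (Fin.le_last r)
  have hhead : 0 < t → C 0 = ∅ := fun hpos => by
    refine Finset.eq_empty_of_forall_notMem fun i hi => ?_
    rw [hmem, hv0] at hi
    linarith [hi.1, hi.2]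
  have hsub : ∀ j, t ≤ v j → (C.last \ C j).card ≤ n - 1 := fun j hj => by
    refine (Finset.card_le_card fun i hi => ?_).trans hlt
    rw [Finset.mem_sdiff, hlast, hmem] at hi
    refine Finset.mem_filter.mpr ⟨Finset.mem_univ _, ?_⟩
    by_contra! hle
    exact hi.2 ⟨hi.1, hle.trans hj⟩
  have hC : C ∈ chains m n := by
    refine ⟨fun hne => hsub 0 ?_, fun _ j hj => hsub j ?_⟩
    · rw [hv0]
      by_contra! hpos
      exact hne (hhead hpos)
    · have hj0 : j ≠ 0 := by rintro rfl; simp at hj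
      obtain ⟨j', rfl⟩ := Fin.exists_succ_eq.mpr hj0
      exact hval j'
  have hlam : ∀ j : Fin C.length, 0 < v j.succ - v j.castSucc := fun j =>
    sub_pos.mpr (hv Fin.castSucc_lt_succ)
  refine ⟨C, hC, ∑ j : Fin C.length,
    (v j.succ - v j.castSucc) * cap n (C.last \ C j.castSucc).card, fun x hx => ?_⟩
  have hdot := dotProduct_eq_sum_levels c hv hv0 (fun i hi => hc i ((hlast i).mp hi))
    (fun j i hi => (hmem j i).trans (and_iff_right ((hlast i).mp hi))) x
  have hgap : ∀ j : Fin C.length, 0 ≤ (v j.succ - v j.castSucc) *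
      (cap n (C.last \ C j.castSucc).card - ∑ i ∈ C.last \ C j.castSucc, x i) := fun j =>
    mul_nonneg (hlam j).le (sub_nonneg.mpr (sum_le_cap_of_mem_polytope hx _))
  -- For `t > 0` the first member is empty and the first step is at least `t`; as the total is at
  -- most `binom(n+1, 2)`, the first slack covers the mass outside `A_ℓ`.
  have hgaps : t * ∑ i ∈ C.lastᶜ, x i ≤ ∑ j : Fin C.length, (v j.succ - v j.castSucc) *
      (cap n (C.last \ C j.castSucc).card - ∑ i ∈ C.last \ C j.castSucc, x i) := by
    rcases ht0.eq_or_lt with h0 | hpos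
    · rw [← h0, zero_mul]
      exact Finset.sum_nonneg fun j _ => hgap j
    have hcard : n ≤ C.last.card := (hge hpos).trans_eq
      (congrArg Finset.card (Finset.ext fun i => by simp [hlast]))
    have hL : 0 < C.length := by
      by_contra! h
      have : C.last = C 0 := congrArg C (Fin.ext (by simpa using h))
      rw [this, hhead hpos] at hcard
      simp at hcard
      omega
    refine le_trans ?_ (Finset.single_le_sum (fun j _ => hgap j) (Finset.mem_univ ⟨0, hL⟩))
    have hz : (⟨0, hL⟩ : Fin C.length).castSucc = 0 := rfl
    rw [hz, hv0, hhead hpos, sub_zero, Finset.sdiff_empty, cast_cap_of_le hcard]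
    have h1 := sum_univ_le_choose hx
    rw [← Finset.sum_add_sum_compl C.last] at h1
    exact mul_le_mul (hval _) (by linarith)
      (Finset.sum_nonneg fun i _ => nonneg_of_mem_polytope hx i) (ht0.trans (hval _))
  have hout : ∀ i ∈ C.lastᶜ, 0 ≤ (t - c i) * x i := fun i hi => by
    rw [Finset.mem_compl, hlast, not_le] at hi
    exact mul_nonneg (sub_nonneg.mpr hi.le) (nonneg_of_mem_polytope hx i)
  -- The deficit splits into two parts, nonnegative by `hgaps` and `hout`; at a maximizer both
  -- vanish.
  have hid : ∑ j : Fin C.length, (v j.succ - v j.castSucc) *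
        (cap n (C.last \ C j.castSucc).card : ℝ) - c ⬝ᵥ x =
      ∑ j : Fin C.length, (v j.succ - v j.castSucc) *
        (cap n (C.last \ C j.castSucc).card - ∑ i ∈ C.last \ C j.castSucc, x i) -
      t * ∑ i ∈ C.lastᶜ, x i + ∑ i ∈ C.lastᶜ, (t - c i) * x i := by
    rw [hdot]
    simp only [mul_sub, sub_mul, Finset.sum_sub_distrib, Finset.mul_sum]
    ring
  have hout' := Finset.sum_nonneg hout
  refine ⟨by linarith, fun h => ?_, fun h => ?_⟩
  · have hx0 : ∀ i, i ∉ C.last → x i = 0 := fun i hi => by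
      have h1 := (Finset.sum_eq_zero_iff_of_nonneg hout).mp (by linarith) i
        (Finset.mem_compl.mpr hi)
      rw [hlast, not_le] at hi
      exact (mul_eq_zero.mp h1).resolve_left (sub_pos.mpr hi).ne'
    have hz : ∑ i ∈ C.lastᶜ, x i = 0 :=
      Finset.sum_eq_zero fun i hi => hx0 i (Finset.mem_compl.mp hi)
    rw [hz, mul_zero] at hid
    rw [mem_chainFace]
    refine ⟨hx, hx0, Fin.lastCases (by simp [RelSeries.last, cap]) fun j => ?_⟩
    have h1 := (Finset.sum_eq_zero_iff_of_nonneg fun j _ => hgap j).mp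
      (le_antisymm (by linarith) (Finset.sum_nonneg fun j _ => hgap j)) j (Finset.mem_univ _)
    have := (mul_eq_zero.mp h1).resolve_left (hlam j).ne'
    linarith
  · obtain ⟨-, h0, h1⟩ := (mem_chainFace C x).mp h
    have hz : ∑ i ∈ C.lastᶜ, c i * x i = 0 := Finset.sum_eq_zero fun i hi => by
      rw [h0 i (Finset.mem_compl.mp hi), mul_zero]
    rw [hdot, hz, add_zero]
    simp only [h1]

theorem exists_chainFace_eq_of_isFace (hn : 0 < n) {F : Set (Fin m → ℝ)}
    (hF : IsFace (polytope m n) F) (hne : F.Nonempty) : ∃ C ∈ chains m n, chainFace n C = F := by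
  obtain ⟨a, b, hab, rfl⟩ := hF
  obtain ⟨C, hC, M, hM⟩ := exists_chain_maximizing hn (-a)
  refine ⟨C, hC, ?_⟩
  simp only [neg_dotProduct] at hM
  obtain ⟨y, hy⟩ := chainFace_nonempty n C
  obtain ⟨z, hz, hzb⟩ := hne
  have h1 := (hM y hy.1).2.mpr hy
  have h2 := (hM z hz).1
  have h3 := hab y hy.1
  rw [Set.mem_ofPred_eq] at hzb
  ext x
  rw [Set.mem_inter_iff, Set.mem_ofPred_eq]
  refine ⟨fun hx => ⟨hx.1, ?_⟩, fun hx => (hM x hx.1).2.mp ?_⟩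
  · have := (hM x hx.1).2.mpr hx
    linarith
  · rw [hx.2]
    linarith

/-! ### Chain faces are faces, and their hyperplanes cut out facets -/

/-- The sum of all the valid inequalities is tight exactly where each of them is. -/
theorem isFace_chainFace (C : BoolChain m) : IsFace (polytope m n) (chainFace n C) := by
  refine ⟨∑ i ∈ C.lastᶜ, Pi.single i 1 -
      ∑ j, (fun i => if i ∈ C.last \ C j then (1 : ℝ) else 0),
    -∑ j, (cap n (C.last \ C j).card : ℝ), ?_⟩
  have hdot : ∀ x : Fin m → ℝ, (∑ i ∈ C.lastᶜ, Pi.single i 1 -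
      ∑ j, (fun i => if i ∈ C.last \ C j then (1 : ℝ) else 0)) ⬝ᵥ x =
      ∑ i ∈ C.lastᶜ, x i - ∑ j, ∑ i ∈ C.last \ C j, x i := fun x => by
    rw [sub_dotProduct, sum_dotProduct, sum_dotProduct]
    simp only [indicator_dotProduct, single_one_dotProduct]
  have hle : ∀ x ∈ polytope m n, ∀ j ∈ Finset.univ,
      ∑ i ∈ C.last \ C j, x i ≤ (cap n (C.last \ C j).card : ℝ) := fun x hx j _ =>
    sum_le_cap_of_mem_polytope hx _
  have hnn : ∀ x ∈ polytope m n, ∀ i ∈ C.lastᶜ, 0 ≤ x i := fun x hx i _ =>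
    nonneg_of_mem_polytope hx i
  refine ⟨fun x hx => ?_, Set.ext fun x => ?_⟩
  · rw [hdot]
    linarith [Finset.sum_le_sum (hle x hx), Finset.sum_nonneg (hnn x hx)]
  · rw [mem_chainFace, Set.mem_inter_iff, Set.mem_ofPred_eq, hdot]
    refine and_congr_right fun hx => ⟨fun h => ?_, fun h => ?_⟩
    · rw [Finset.sum_eq_zero fun i hi => h.1 i (Finset.mem_compl.mp hi), zero_sub]
      simp only [h.2]
    · have h1 := Finset.sum_le_sum (hle x hx)
      have h2 := Finset.sum_nonneg (hnn x hx)
      refine ⟨fun i hi => ?_, fun j => ?_⟩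
      · exact (Finset.sum_eq_zero_iff_of_nonneg (hnn x hx)).mp (by linarith) i
          (Finset.mem_compl.mpr hi)
      · exact (Finset.sum_eq_sum_iff_of_le (hle x hx)).mp (by linarith) j (Finset.mem_univ _)

/-- The chain with a single member. -/
def singletonChain (A : Finset (Fin m)) : BoolChain m := RelSeries.singleton _ A

/-- The chain with two members, the larger of which is the whole set. -/
def pairChain (A : Finset (Fin m)) (hA : A ⊂ Finset.univ) : BoolChain m where
  length := 1
  toFun := ![A, Finset.univ]
  step j := by
    obtain rfl : j = 0 := Subsingleton.elim _ _
    exact hA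

theorem singletonChain_mem_chains (A : Finset (Fin m)) : singletonChain A ∈ chains m n := by
  refine ⟨fun _ => ?_, fun _ j hj => ?_⟩
  · simp [singletonChain]
  · have : (j : ℕ) < 1 := j.2
    omega

theorem chainFace_singletonChain (A : Finset (Fin m)) :
    chainFace n (singletonChain A) = polytope m n ∩ {x | ∀ i, i ∉ A → x i = 0} := by
  ext x
  rw [mem_chainFace]
  have hl : (singletonChain A).last = A := rfl
  have hj : ∀ j, singletonChain A j = A := fun _ => rfl
  simp [hl, hj, cap]

theorem dim_polytope (hn : 0 < n) : dim (polytope m n) = m := by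
  have h := dim_chainFace_add_length hn (singletonChain_mem_chains (m := m) Finset.univ)
  have he : chainFace n (singletonChain (Finset.univ : Finset (Fin m))) = polytope m n := by
    simp [chainFace_singletonChain]
  rw [he] at h
  simpa [singletonChain] using h

theorem isFacet_chainFace (hn : 0 < n) {C : BoolChain m} (hC : C ∈ chains m n)
    (hcard : C.last.card + 1 = m + C.length) : IsFacet (polytope m n) (chainFace n C) := by
  refine ⟨isFace_chainFace C, chainFace_nonempty n C, ?_⟩
  have := dim_chainFace_add_length hn hC
  rw [dim_polytope hn]
  omega

theorem isFacet_coordinate (hn : 0 < n) (i : Fin m) :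
    IsFacet (polytope m n) (polytope m n ∩ {x | x i = 0}) := by
  have he : chainFace n (singletonChain (Finset.univ.erase i)) =
      polytope m n ∩ {x | x i = 0} := by
    simp [chainFace_singletonChain]
  rw [← he]
  refine isFacet_chainFace hn (singletonChain_mem_chains _) ?_
  have := i.pos
  simp [singletonChain]
  omega

theorem chainFace_pairChain (A : Finset (Fin m)) (hA : A ⊂ Finset.univ) :
    chainFace n (pairChain A hA) = polytope m n ∩ {x | ∑ i ∈ Aᶜ, x i = cap n Aᶜ.card} := by
  ext x
  rw [mem_chainFace]
  have h0 : pairChain A hA 0 = A := rfl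
  have h1 : pairChain A hA 1 = Finset.univ := rfl
  have hl : (pairChain A hA).last = Finset.univ := rfl
  refine and_congr_right fun _ => ⟨fun h => ?_, fun h => ⟨by simp [hl], fun j => ?_⟩⟩
  · have := h.2 0
    rwa [hl, h0, ← Finset.compl_eq_univ_sdiff] at this
  · rw [hl]
    have hj : j = 0 ∨ j = 1 := by
      have : (j : ℕ) < 2 := j.2
      rcases Nat.lt_or_ge j 1 with h | h
      · exact Or.inl (Fin.ext (by simpa using h))
      · exact Or.inr (Fin.ext (show (j : ℕ) = 1 by omega))
    rcases hj with rfl | rfl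
    · rwa [h0, ← Finset.compl_eq_univ_sdiff]
    · simp [h1, cap]

theorem isFacet_sum (hn : 0 < n) {S : Finset (Fin m)} (hne : S.Nonempty)
    (hS : S = Finset.univ ∨ S.card ≤ n - 1) :
    IsFacet (polytope m n) (polytope m n ∩ {x | ∑ i ∈ S, x i = cap n S.card}) := by
  have hA : Sᶜ ⊂ Finset.univ := by
    rw [Finset.ssubset_univ_iff, Ne, Finset.compl_eq_univ_iff]
    exact hne.ne_empty
  have he := chainFace_pairChain (n := n) Sᶜ hA
  rw [compl_compl] at he
  rw [← he]
  have hl : (pairChain Sᶜ hA).last = Finset.univ := rfl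
  have hh : (pairChain Sᶜ hA).head = Sᶜ := rfl
  refine isFacet_chainFace hn ⟨fun h => ?_, fun _ j hj => ?_⟩ ?_
  · rw [hl, hh, ← Finset.compl_eq_univ_sdiff, compl_compl]
    refine hS.resolve_left ?_
    rintro rfl
    exact h (by rw [hh, Finset.compl_univ])
  · obtain rfl : j = 1 := Fin.ext hj
    have : pairChain Sᶜ hA 1 = Finset.univ := rfl
    simp [this, hl]
  · rw [hl]
    simp [pairChain]

theorem isFacet_of_mem_hyperplanes (hn : 0 < n) {C : BoolChain m} (hC : C ∈ chains m n)
    {H : Set (Fin m → ℝ)} (hH : H ∈ hyperplanes n C) :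
    IsFacet (polytope m n) (polytope m n ∩ H) := by
  rcases hH with (⟨i, -, rfl⟩ | ⟨j, hj, hj', rfl⟩) | ⟨hh, hle, rfl⟩
  · exact isFacet_coordinate hn i
  · simp only [← cast_cap]
    refine isFacet_sum hn ?_ (Or.inr ?_)
    · exact Finset.sdiff_nonempty.mpr (not_le_of_gt (C.strictMono (show j < Fin.last _ from hj)))
    · by_cases hh : C.head = ∅
      · by_cases hj0 : (j : ℕ) = 0
        -- The exception for `j = 1` in (ii) is what excludes `|A_ℓ| ≥ n` here.
        · have : n > C.last.card := by
            by_contra! h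
            exact hj' ⟨hj0, hh, h⟩
          have := Finset.card_le_card (Finset.sdiff_subset (s := C.last) (t := C j))
          omega
        · refine (Finset.card_le_card (Finset.sdiff_subset_sdiff le_rfl ?_)).trans
            (hC.2 hh ⟨1, by omega⟩ rfl)
          exact C.strictMono.monotone (Fin.mk_le_of_le_val (by omega))
      · refine (Finset.card_le_card (Finset.sdiff_subset_sdiff le_rfl ?_)).trans (hC.1 hh)
        exact C.strictMono.monotone (Fin.zero_le j)
  · have hcard : n ≤ (Finset.univ : Finset (Fin m)).card := hle.trans (Finset.card_le_univ _)
    rw [← cast_cap_of_le hcard]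
    exact isFacet_sum hn (Finset.card_pos.mp (by omega)) (Or.inl rfl)

end PartialPermutohedron

theorem mainTheorem1 (m n : ℕ) (hm : 0 < m) (hn : 0 < n) :
    Set.BijOn (fun C : PartialPermutohedron.BoolChain m => PartialPermutohedron.chainFace n C)
      (PartialPermutohedron.chains m n)
      {F | PartialPermutohedron.IsFace (PartialPermutohedron.polytope m n) F ∧ F.Nonempty} ∧
    (∀ C ∈ PartialPermutohedron.chains m n, ∀ H ∈ PartialPermutohedron.hyperplanes n C,
      PartialPermutohedron.IsFacet (PartialPermutohedron.polytope m n)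
        (PartialPermutohedron.polytope m n ∩ H)) ∧
    (∀ C ∈ PartialPermutohedron.chains m n,
      PartialPermutohedron.dim (PartialPermutohedron.chainFace n C) =
        (PartialPermutohedron.missingRanks C).ncard) :=
  ⟨⟨fun C _ => ⟨PartialPermutohedron.isFace_chainFace C,
        PartialPermutohedron.chainFace_nonempty n C⟩,
      PartialPermutohedron.chainFace_injOn hn,
      fun _ hF => PartialPermutohedron.exists_chainFace_eq_of_isFace hn hF.1 hF.2⟩,
    fun _ hC _ hH => PartialPermutohedron.isFacet_of_mem_hyperplanes hn hC hH,
    fun _ hC => PartialPermutohedron.dim_chainFace hn hC⟩
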